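/- Let $E$ be a real Banach lattice. An orthomorphism of $E$ is a linear operator $T\colon E\to E$ that is order bounded (it maps order intervals into order intervals) and band preserving ($T(B)\subseteq B$ for every band $B$ of $E$); $\mathrm{Orth}(E)$ denotes the algebra of all orthomorphisms of $E$, with composition as product, ordered by $S\le T$ if and only if $Sx\le Tx$ for all $x\ge 0$ in $E$. Every orthomorphism is a bounded operator; with the operator norm, $\mathrm{Orth}(E)$ is a Banach $f$-algebra with the identity operator $I$ as a strong order unit, and the operator norm coincides with the order unit norm $\|T\|_I=\inf\{\lambda\ge 0 : |T|\le\lambda I\}$. Let $\mathcal S$ be a non-empty set of bounded linear operators on $E$. Then the commutant $$\{\,T\in\mathrm{Orth}(E) : TS=ST\text{ for all }S\in\mathcal S\,\}$$ of $\mathcal S$ in $\mathrm{Orth}(E)$ is a Banach $f$-subalgebra of $\mathrm{Orth}(E)$ that contains $I$ as a strong order unit: it is a subalgebra and a vector sublattice of $\mathrm{Orth}(E)$, and with the restricted operations, ordering and norm it is itself a Banach $f$-algebra, in which $I$ is a strong order unit. Here an $f$-algebra is an Archimedean vector lattice with an associative bilinear multiplication such that products of positive elements are positive and such that $a\wedge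 b=0$ and $c\ge 0$ imply $(ac)\wedge b=(ca)\wedge b=0$. A Banach $f$-algebra is an $f$-algebra with a complete submultiplicative norm that is a lattice norm ($|a|\le|b|$ implies $\|a\|\le\|b\|$). A positive element $e$ of a vector lattice is a strong order unit if for every $a$ there is a real $\lambda\ge0$ with $|a|\le\lambda e$. -/

import Mathlib

section VectorLattice

variable {E : Type*} [AddCommGroup E] [Lattice E] [Module ℝ E]

/-- A band of a vector lattice: a linear subspace that is solid (so an ideal) and that contains the
supremum, taken in `E`, of each of its subsets that has one. -/
structure IsBand (B : Submodule ℝ E) : Prop where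
  solid : ∀ ⦃x y : E⦄, y ∈ B → |x| ≤ |y| → x ∈ B
  isLUB_mem : ∀ ⦃D : Set E⦄ ⦃s : E⦄, (∀ x ∈ D, x ∈ B) → IsLUB D s → s ∈ B

/-- A linear operator is band preserving if it maps every band into itself. -/
def IsBandPreserving (T : Module.End ℝ E) : Prop :=
  ∀ B : Submodule ℝ E, IsBand B → ∀ x ∈ B, T x ∈ B

/-- A linear operator is order bounded if it maps order intervals into order intervals. -/
def IsOrderBoundedOp (T : Module.End ℝ E) : Prop :=
  ∀ a b : E, ∃ c d : E, ∀ x ∈ Set.Icc a b, T x ∈ Set.Icc c d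

variable (E) in
/-- The algebra `Orth(E)` of orthomorphisms of the vector lattice `E`: the order bounded, band
preserving linear operators. -/
def Orth [IsOrderedAddMonoid E] [IsOrderedModule ℝ E] : Subalgebra ℝ (Module.End ℝ E) where
  carrier := {T | IsOrderBoundedOp T ∧ IsBandPreserving T}
  mul_mem' := by
    rintro S T ⟨hS, hS'⟩ ⟨hT, hT'⟩
    refine ⟨fun a b => ?_, fun B hB x hx => hS' B hB _ (hT' B hB x hx)⟩
    obtain ⟨c, d, h⟩ := hT a b
    obtain ⟨c', d', h'⟩ := hS c d
    exact ⟨c', d', fun x hx => h' _ (h x hx)⟩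
  add_mem' := by
    rintro S T ⟨hS, hS'⟩ ⟨hT, hT'⟩
    refine ⟨fun a b => ?_, fun B hB x hx => B.add_mem (hS' B hB x hx) (hT' B hB x hx)⟩
    obtain ⟨c, d, h⟩ := hS a b
    obtain ⟨c', d', h'⟩ := hT a b
    exact ⟨c + c', d + d', fun x hx =>
      ⟨add_le_add (h x hx).1 (h' x hx).1, add_le_add (h x hx).2 (h' x hx).2⟩⟩
  algebraMap_mem' := by
    intro r
    refine ⟨fun a b => ?_, fun B _ x hx => ?_⟩
    · rcases le_total 0 r with hr | hr
      · refine ⟨r • a, r • b, fun x hx => ?_⟩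
        rw [Module.algebraMap_end_apply]
        exact ⟨smul_le_smul_of_nonneg_left hx.1 hr, smul_le_smul_of_nonneg_left hx.2 hr⟩
      · refine ⟨r • b, r • a, fun x hx => ?_⟩
        rw [Module.algebraMap_end_apply]
        exact ⟨smul_le_smul_of_nonpos_left hx.2 hr, smul_le_smul_of_nonpos_left hx.1 hr⟩
    · rw [Module.algebraMap_end_apply]
      exact B.smul_mem r hx

/-- The operator order: `S ≤ T` if and only if `S x ≤ T x` for all `x ≥ 0`. -/
instance Orth.instPartialOrder [IsOrderedAddMonoid E] [IsOrderedModule ℝ E] :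
    PartialOrder (Orth E) where
  le S T := ∀ x : E, 0 ≤ x → (S : Module.End ℝ E) x ≤ (T : Module.End ℝ E) x
  le_refl _ _ _ := le_rfl
  le_trans _ _ _ h₁ h₂ x hx := (h₁ x hx).trans (h₂ x hx)
  le_antisymm S T h₁ h₂ := by
    refine Subtype.ext (LinearMap.ext fun x => ?_)
    have key : ∀ y : E, 0 ≤ y → (S : Module.End ℝ E) y = (T : Module.End ℝ E) y :=
      fun y hy => le_antisymm (h₁ y hy) (h₂ y hy)
    rw [← posPart_sub_negPart x, map_sub, map_sub, key _ (posPart_nonneg x),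
      key _ (negPart_nonneg x)]

end VectorLattice

section BanachLattice

variable {E : Type*} [NormedAddCommGroup E] [NormedSpace ℝ E] [Lattice E] [IsOrderedAddMonoid E]
  [HasSolidNorm E] [CompleteSpace E]

/-- Order bounded linear operators on a Banach lattice are norm bounded. -/
theorem IsOrderBoundedOp.continuous {T : Module.End ℝ E} (hT : IsOrderBoundedOp T) :
    Continuous T := by
  suffices h : ∃ C : ℝ, ∀ x, ‖T x‖ ≤ C * ‖x‖ by
    obtain ⟨C, hC⟩ := h
    exact (T.mkContinuous C hC).continuous
  by_contra! hcon
  have hex : ∀ n : ℕ, ∃ y : E, ‖y‖ ≤ (1 / 2 : ℝ) ^ n ∧ (n : ℝ) ≤ ‖T y‖ := by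
    intro n
    obtain ⟨x, hx⟩ := hcon ((n : ℝ) * 2 ^ n)
    have hx0 : 0 < ‖x‖ := by
      rw [norm_pos_iff]
      rintro rfl
      simp at hx
    refine ⟨((1 / 2 : ℝ) ^ n * ‖x‖⁻¹) • x, ?_, ?_⟩
    · rw [norm_smul, Real.norm_of_nonneg (by positivity), mul_assoc, inv_mul_cancel₀ hx0.ne',
        mul_one]
    · rw [map_smul, norm_smul, Real.norm_of_nonneg (by positivity)]
      calc (n : ℝ) = ((1 / 2 : ℝ) ^ n * ‖x‖⁻¹) * ((n : ℝ) * 2 ^ n * ‖x‖) := by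
            rw [one_div, inv_pow]; field_simp
        _ ≤ _ := by gcongr
  choose y hy hy' using hex
  have hsum : Summable fun n => |y n| :=
    Summable.of_norm_bounded summable_geometric_two fun n => by
      rw [norm_abs_eq_norm]; exact hy n
  have hle : ∀ n, |y n| ≤ ∑' k, |y k| := fun n =>
    hsum.le_tsum n fun k _ => abs_nonneg (y k)
  obtain ⟨c, d, hcd⟩ := hT (-∑' k, |y k|) (∑' k, |y k|)
  have hb : ∀ n, ‖T (y n)‖ ≤ ‖|c| ⊔ |d|‖ := by
    intro n
    have hm := hcd (y n) ⟨(neg_le_neg (hle n)).trans (neg_le.1 (neg_le_abs (y n))), (le_abs_self _).trans (hle n)⟩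
    refine norm_le_norm_of_abs_le_abs ?_
    refine le_trans ?_ (le_abs_self _)
    refine abs_le'.2 ⟨(hm.2.trans (le_abs_self d)).trans le_sup_right, ?_⟩
    exact ((neg_le_neg hm.1).trans (neg_le_abs c)).trans le_sup_left
  obtain ⟨n, hn⟩ := exists_nat_gt ‖|c| ⊔ |d|‖
  exact absurd ((hy' n).trans (hb n)) (not_le.2 hn)

variable [IsOrderedModule ℝ E]

/-- The inclusion of `Orth(E)` into the bounded operators on a Banach lattice `E`. -/
def Orth.toCLM : Orth E →ₐ[ℝ] (E →L[ℝ] E) where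
  toFun T := ⟨T, T.2.1.continuous⟩
  map_one' := rfl
  map_mul' _ _ := rfl
  map_zero' := rfl
  map_add' _ _ := rfl
  commutes' _ := rfl

theorem Orth.toCLM_injective : Function.Injective (Orth.toCLM : Orth E → (E →L[ℝ] E)) :=
  fun _ _ h => Subtype.ext (congrArg ContinuousLinearMap.toLinearMap h)

/-- `Orth(E)` is supplied with the operator norm. -/
noncomputable instance Orth.instNormedRing : NormedRing (Orth E) :=
  NormedRing.induced (Orth E) (E →L[ℝ] E) Orth.toCLM Orth.toCLM_injective

noncomputable instance Orth.instNormedAlgebra : NormedAlgebra ℝ (Orth E) :=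
  { (inferInstance : Algebra ℝ (Orth E)) with
    norm_smul_le := fun r T => by
      change ‖Orth.toCLM (r • T)‖ ≤ ‖r‖ * ‖Orth.toCLM T‖
      rw [map_smul]
      exact norm_smul_le r (Orth.toCLM T) }

/-- The commutant in `Orth(E)` of a set of bounded linear operators on `E`. -/
def orthCommutant (𝒮 : Set (E →L[ℝ] E)) : Set (Orth E) :=
  {T | ∀ S ∈ 𝒮, (T : Module.End ℝ E) ∘ₗ (S : E →ₗ[ℝ] E) = (S : E →ₗ[ℝ] E) ∘ₗ (T : Module.End ℝ E)}

end BanachLattice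

section FAlgebra

/-- `A` is an (Archimedean) f-algebra: a vector lattice with an associative multiplication for which
products of positive elements are positive, and such that `a ∧ b = 0` and `c ≥ 0` imply that
`(a c) ∧ b = (c a) ∧ b = 0`. -/
structure IsFAlgebra (A : Type*) [Ring A] [Algebra ℝ A] [PartialOrder A] : Prop where
  add_le_add_left : ∀ a b c : A, a ≤ b → c + a ≤ c + b
  smul_nonneg : ∀ (r : ℝ) (a : A), 0 ≤ r → 0 ≤ a → 0 ≤ r • a
  exists_isLUB : ∀ a b : A, ∃ s, IsLUB {a, b} s
  exists_isGLB : ∀ a b : A, ∃ i, IsGLB {a, b} i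
  archimedean : ∀ a b : A, (∀ n : ℕ, n • a ≤ b) → a ≤ 0
  mul_nonneg : ∀ a b : A, 0 ≤ a → 0 ≤ b → 0 ≤ a * b
  isGLB_mul_right : ∀ a b c : A, IsGLB {a, b} 0 → 0 ≤ c → IsGLB {a * c, b} 0
  isGLB_mul_left : ∀ a b c : A, IsGLB {a, b} 0 → 0 ≤ c → IsGLB {c * a, b} 0

/-- `A` is a Banach f-algebra: an f-algebra with a complete submultiplicative norm that is a lattice
norm, i.e. `|a| ≤ |b|` implies `‖a‖ ≤ ‖b‖`, where `|a|` is the supremum of `a` and `-a`. -/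
structure IsBanachFAlgebra (A : Type*) [NormedRing A] [NormedAlgebra ℝ A] [PartialOrder A] : Prop
    extends IsFAlgebra A where
  complete : CompleteSpace A
  solid : ∀ a b absa absb : A, IsLUB {a, -a} absa → IsLUB {b, -b} absb → absa ≤ absb → ‖a‖ ≤ ‖b‖

/-- The subalgebra `B` of `A` is a Banach f-subalgebra: the supremum and the infimum in `A` of any
two elements of `B` exist and belong to `B`, and `B` is itself a Banach f-algebra when supplied with
the restricted operations, ordering, and norm. -/
structure IsBanachFSubalgebra {A : Type*} [NormedRing A] [NormedAlgebra ℝ A] [PartialOrder A]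
    (B : Subalgebra ℝ A) : Prop where
  sup_mem : ∀ a ∈ B, ∀ b ∈ B, ∃ s ∈ B, IsLUB {a, b} s
  inf_mem : ∀ a ∈ B, ∀ b ∈ B, ∃ i ∈ B, IsGLB {a, b} i
  isBanachFAlgebra : IsBanachFAlgebra B

variable {A : Type*} [AddCommGroup A] [Module ℝ A] [PartialOrder A]

/-- `e` is a strong order unit of the vector lattice `A`: it is positive, and every `a` satisfies
`|a| ≤ r e`, i.e. `-r e ≤ a ≤ r e`, for some real `r ≥ 0`. -/
def IsStrongOrderUnit (e : A) : Prop :=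
  0 ≤ e ∧ ∀ a : A, ∃ r : ℝ, 0 ≤ r ∧ -(r • e) ≤ a ∧ a ≤ r • e

/-- The order unit norm `‖a‖ₑ = inf {r ≥ 0 : |a| ≤ r e}` of a strong order unit `e`. -/
noncomputable def orderUnitNorm (e a : A) : ℝ :=
  sInf {r : ℝ | 0 ≤ r ∧ -(r • e) ≤ a ∧ a ≤ r • e}

end FAlgebra

/-!
An orthomorphism `T` behaves like multiplication by a function, and the proof makes this precise
without a representation theorem. The disjoint complement of a positive element is a band, so `T` is
local: `x ∧ y = 0` implies `|T x| ∧ y = 0`. The role of points is played by the prime ideals `P` of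
`E`, solid subspaces modulo which the order is total; every nonzero element is outside one of them
(`exists_isPrimeIdeal_notMem`). Given positive `x`, `y` and `n`, a prime ideal `P` and `e = x + y`
outside `P`, there is a constant `α` in `[0, 1]` such that `x - α e` and `T (x - α e)` are both of
order `1 / n` modulo `P` (`IsPrimeIdeal.exists_approx`). As `E` is Archimedean, errors of order
`1 / n` may be neglected (`eq_zero_of_leMod`).

Two consequences carry the theorem. First, for `r ≥ 0` and `x ≥ 0` the element `u = (|T x| - r x)⁺`
satisfies `r u ≤ |T u|` (`smul_le_abs_map_posPart`). When `r > ‖T‖` this forces `u = 0`, so that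
`|T x| ≤ ‖T‖ |x|` (`Orth.abs_apply_le`): the operator norm is the order unit norm of the identity.
It follows that `Orth(E)` is closed in the bounded operators, and the f-algebra and lattice norm
axioms other than the existence of suprema are formal (`IsUnitOrderedAlgebra.isBanachFAlgebra`).
Second, `T x` and `T y` do not have opposite signs for `x, y ≥ 0` (`posPart_map_inf_negPart_map`),
so `x ↦ |T x|` is additive on the positive cone and extends to the modulus `|T|`
(`Orth.exists_modulus`).

The commutant of a set of bounded operators is a closed unital subalgebra of `Orth(E)`. It contains
the modulus of each of its elements because `|T|² = T²` (`Orth.modulus_mul_self`) and the iteration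
`p ↦ p + (T² - p²) / 2`, started at `0`, converges in norm to `|T|` when `|T| ≤ 1`
(`IsUnitOrderedAlgebra.mem_of_sq_eq`).
-/

/-! ### Disjointness in vector lattices -/

namespace VectorLattice

section Lattice

variable {E : Type*} [AddCommGroup E] [Lattice E]

theorem inf_eq_zero_of_le {a b c : E} (hc : 0 ≤ c) (h : a ⊓ b = 0) (hb : 0 ≤ b)
    (hca : c ≤ a) : c ⊓ b = 0 :=
  le_antisymm ((inf_le_inf_right b hca).trans h.le) (le_inf hc hb)

variable [IsOrderedAddMonoid E]

theorem eq_zero_of_abs_le_zero {a : E} (h : |a| ≤ 0) : a = 0 :=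
  le_antisymm ((le_abs_self a).trans h) (neg_nonpos.1 ((neg_le_abs a).trans h))

theorem add_inf_le_inf_add_inf {a b c : E} (ha : 0 ≤ a) (hb : 0 ≤ b) (hc : 0 ≤ c) :
    (a + b) ⊓ c ≤ a ⊓ c + b ⊓ c := by
  have h1 : (a + b) ⊓ c - a ≤ b ⊓ c :=
    le_inf (sub_le_iff_le_add'.2 inf_le_left) ((sub_le_self _ ha).trans inf_le_right)
  have h2 : (a + b) ⊓ c - c ≤ b ⊓ c :=
    (sub_nonpos.2 inf_le_right).trans (le_inf hb hc)
  have h3 : (a + b) ⊓ c - b ⊓ c ≤ a ⊓ c := le_inf (sub_le_comm.1 h1) (sub_le_comm.1 h2)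
  exact sub_le_iff_le_add.1 h3

theorem abs_add_of_inf_eq_zero {a b : E} (h₁ : a⁺ ⊓ b⁻ = 0) (h₂ : b⁺ ⊓ a⁻ = 0) :
    |a + b| = |a| + |b| := by
  have ha : a⁺ ⊓ a⁻ = 0 := posPart_inf_negPart_eq_zero a
  have hb : b⁺ ⊓ b⁻ = 0 := posPart_inf_negPart_eq_zero b
  have h : (a⁺ + b⁺) ⊓ (a⁻ + b⁻) ≤ 0 := by
    refine (add_inf_le_inf_add_inf (posPart_nonneg a) (posPart_nonneg b)
      (add_nonneg (negPart_nonneg a) (negPart_nonneg b))).trans ?_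
    rw [inf_comm, inf_comm b⁺]
    refine (add_le_add (add_inf_le_inf_add_inf (negPart_nonneg a) (negPart_nonneg b)
      (posPart_nonneg a)) (add_inf_le_inf_add_inf (negPart_nonneg a) (negPart_nonneg b)
      (posPart_nonneg b))).trans ?_
    rw [inf_comm a⁻, inf_comm b⁻, inf_comm a⁻, inf_comm b⁻, ha, hb, h₁, h₂]
    simp
  refine le_antisymm (abs_add_le a b) ?_
  have key : |a| + |b| = (a⁺ + b⁺) ⊓ (a⁻ + b⁻) + (a⁺ + b⁺) ⊔ (a⁻ + b⁻) := by
    rw [inf_add_sup, ← posPart_add_negPart a, ← posPart_add_negPart b]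
    abel
  have e1 : a⁺ + b⁺ = (a + b) + (a⁻ + b⁻) := by
    rw [eq_add_of_sub_eq (posPart_sub_negPart a), eq_add_of_sub_eq (posPart_sub_negPart b)]
    abel
  have h' : |a + b| = (a⁺ + b⁺) ⊔ (a⁻ + b⁻) - (a⁺ + b⁺) ⊓ (a⁻ + b⁻) := by
    rw [sup_sub_inf_eq_abs_sub, abs_sub_comm]
    congr 1
    rw [e1]; abel
  rw [key, h']
  have := add_le_add h h
  rw [← sub_nonneg]
  have e2 : ∀ s i : E, s - i - (i + s) = -(i + i) := fun s i => by abel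
  rw [e2]
  exact neg_nonneg.2 (by simpa using this)

end Lattice

variable {E : Type*} [AddCommGroup E] [Lattice E] [Module ℝ E]

section SMul

variable [IsOrderedModule ℝ E]

theorem smul_inf {r : ℝ} (hr : 0 ≤ r) (a b : E) : r • (a ⊓ b) = r • a ⊓ r • b := by
  rcases hr.eq_or_lt with rfl | hr
  · simp
  · exact (OrderIso.smulRight hr).map_inf a b

theorem abs_smul_of_nonneg {r : ℝ} (hr : 0 ≤ r) (a : E) : |r • a| = r • |a| := by
  rcases hr.eq_or_lt with rfl | hr
  · simp [abs]
  · have := (OrderIso.smulRight (β := E) hr).map_sup a (-a)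
    simp only [OrderIso.smulRight_apply, smul_neg] at this
    exact this.symm

theorem abs_smul_eq (r : ℝ) (a : E) : |r • a| = |r| • |a| := by
  rcases le_total 0 r with hr | hr
  · rw [abs_smul_of_nonneg hr, abs_of_nonneg hr]
  · rw [← abs_neg, ← neg_smul, abs_smul_of_nonneg (neg_nonneg.2 hr), abs_of_nonpos hr]

end SMul

variable [IsOrderedAddMonoid E]

theorem smul_inf_eq_zero [IsOrderedModule ℝ E] {a b : E} (h : a ⊓ b = 0) (ha : 0 ≤ a)
    (hb : 0 ≤ b) {r : ℝ} (hr : 0 ≤ r) : (r • a) ⊓ b = 0 := by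
  have h1 : ((r + 1) • a) ⊓ ((r + 1) • b) = 0 := by
    rw [← smul_inf (by positivity), h, smul_zero]
  have hb' : b ≤ (r + 1) • b := by
    rw [add_smul, one_smul]
    exact le_add_of_nonneg_left (smul_nonneg hr hb)
  have ha' : r • a ≤ (r + 1) • a := by
    rw [add_smul, one_smul]
    exact le_add_of_nonneg_right ha
  exact le_antisymm ((inf_le_inf ha' hb').trans h1.le) (le_inf (smul_nonneg hr ha) hb)

/-- The disjoint complement `{x : |x| ∧ y = 0}` of a positive element `y`. -/
def disjointCompl [IsOrderedModule ℝ E] (y : E) (hy : 0 ≤ y) : Submodule ℝ E where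
  carrier := {x | |x| ⊓ y = 0}
  zero_mem' := by simpa using hy
  add_mem' := by
    intro a b ha hb
    refine le_antisymm ?_ (le_inf (abs_nonneg _) hy)
    calc |a + b| ⊓ y ≤ (|a| + |b|) ⊓ y := inf_le_inf_right _ (abs_add_le a b)
      _ ≤ |a| ⊓ y + |b| ⊓ y := add_inf_le_inf_add_inf (abs_nonneg a) (abs_nonneg b) hy
      _ = 0 := by rw [ha, hb, add_zero]
  smul_mem' := by
    intro r a ha
    change |r • a| ⊓ y = 0
    rw [abs_smul_eq]
    exact smul_inf_eq_zero ha (abs_nonneg a) hy (abs_nonneg r)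

theorem isBand_disjointCompl [IsOrderedModule ℝ E] (y : E) (hy : 0 ≤ y) :
    IsBand (disjointCompl y hy) where
  solid x z hz hxz := inf_eq_zero_of_le (abs_nonneg x) hz hy hxz
  isLUB_mem := by
    intro D s hD hs
    -- a supremum of the empty set is a least element of `E`, and then `E` is trivial
    rcases D.eq_empty_or_nonempty with rfl | ⟨d₀, hd₀⟩
    · rw [isLUB_empty_iff] at hs
      have hy0 : y ≤ 0 := by simpa using hs (s - y)
      exact le_antisymm (inf_le_right.trans hy0) (le_inf (abs_nonneg s) hy)
    have hpos : s⁺ ⊓ y ≤ 0 := by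
      have hub : s ≤ s - s⁺ ⊓ y := by
        refine hs.2 fun d hd => ?_
        have hw : d⁺ ⊓ (s⁺ ⊓ y) = 0 := by
          refine le_antisymm ?_ (le_inf (posPart_nonneg d) (le_inf (posPart_nonneg s) hy))
          refine (inf_le_inf_left _ inf_le_right).trans ?_
          refine (inf_le_inf_right y ?_).trans (hD d hd).le
          rw [← posPart_add_negPart d]
          exact le_add_of_nonneg_right (negPart_nonneg d)
        have h1 : d⁺ + s⁺ ⊓ y ≤ s⁺ := by
          rw [← inf_add_sup, hw, zero_add]
          exact sup_le (posPart_mono (hs.1 hd)) inf_le_left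
        have h2 : s⁻ ≤ d⁻ := negPart_anti (hs.1 hd)
        rw [← posPart_sub_negPart d, le_sub_iff_add_le]
        calc d⁺ - d⁻ + s⁺ ⊓ y = d⁺ + s⁺ ⊓ y - d⁻ := by abel
          _ ≤ s⁺ - s⁻ := sub_le_sub h1 h2
          _ = s := posPart_sub_negPart s
      simpa using hub
    have hneg : s⁻ ⊓ y ≤ 0 := by
      refine (inf_le_inf_right y ?_).trans (hD d₀ hd₀).le
      refine (negPart_anti (hs.1 hd₀)).trans ?_
      rw [← posPart_add_negPart d₀]
      exact le_add_of_nonneg_left (posPart_nonneg d₀)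
    refine le_antisymm ?_ (le_inf (abs_nonneg s) hy)
    rw [← posPart_add_negPart s]
    exact (add_inf_le_inf_add_inf (posPart_nonneg s) (negPart_nonneg s) hy).trans
      (by simpa using add_le_add hpos hneg)

/-- A linear operator is local if it preserves disjointness to each positive element. -/
def IsLocal (T : Module.End ℝ E) : Prop :=
  ∀ ⦃x y : E⦄, 0 ≤ x → 0 ≤ y → x ⊓ y = 0 → |T x| ⊓ y = 0

theorem _root_.IsBandPreserving.isLocal [IsOrderedModule ℝ E] {T : Module.End ℝ E}
    (hT : IsBandPreserving T) : IsLocal T := by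
  intro x y hx hy h
  refine hT _ (isBand_disjointCompl y hy) x ?_
  change |x| ⊓ y = 0
  rwa [abs_of_nonneg hx]

/-! ### Prime ideals of a vector lattice -/

/-- A prime ideal of a vector lattice: a solid linear subspace that contains one of any two
disjoint positive elements. The quotient by a prime ideal is totally ordered. The whole space counts
as a prime ideal. -/
structure IsPrimeIdeal (P : Submodule ℝ E) : Prop where
  solid : ∀ ⦃x y : E⦄, y ∈ P → |x| ≤ |y| → x ∈ P
  prime : ∀ ⦃x y : E⦄, 0 ≤ x → 0 ≤ y → x ⊓ y = 0 → x ∈ P ∨ y ∈ P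

/-- The elements dominated by some `p + r x` with `p ∈ P` and `r ≥ 0`. For an ideal `P` and `x ≥ 0`
this is the ideal generated by `P` and `x`. -/
def idealAdjoin [IsOrderedModule ℝ E] (P : Submodule ℝ E) (x : E) :
    Submodule ℝ E where
  carrier := {a | ∃ p ∈ P, ∃ r : ℝ, 0 ≤ r ∧ |a| ≤ p + r • x}
  zero_mem' := ⟨0, P.zero_mem, 0, le_rfl, by simp⟩
  add_mem' := by
    rintro a b ⟨p, hp, r, hr, h⟩ ⟨q, hq, s, hs, h'⟩
    refine ⟨p + q, P.add_mem hp hq, r + s, add_nonneg hr hs, (abs_add_le a b).trans ?_⟩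
    refine (add_le_add h h').trans (le_of_eq ?_)
    module
  smul_mem' := by
    rintro c a ⟨p, hp, r, hr, h⟩
    refine ⟨|c| • p, P.smul_mem _ hp, |c| * r, by positivity, ?_⟩
    rw [abs_smul_eq]
    refine (smul_le_smul_of_nonneg_left h (abs_nonneg c)).trans (le_of_eq ?_)
    module

/-- A solid subspace that is maximal among those not containing a given element is prime. -/
theorem exists_isPrimeIdeal_notMem [IsOrderedModule ℝ E] {w : E} (hw : w ≠ 0) :
    ∃ P : Submodule ℝ E, IsPrimeIdeal P ∧ w ∉ P := by
  let 𝒞 : Set (Submodule ℝ E) := {P | (∀ ⦃x y : E⦄, y ∈ P → |x| ≤ |y| → x ∈ P) ∧ w ∉ P}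
  obtain ⟨P, -, hP⟩ := zorn_le_nonempty₀ 𝒞 (fun c hc hchain Q hQ => by
    have hmem : ∀ z, z ∈ sSup c ↔ ∃ R ∈ c, z ∈ R := fun z =>
      Submodule.mem_sSup_of_directed ⟨Q, hQ⟩ hchain.directedOn
    refine ⟨sSup c, ⟨fun x y hy hxy => ?_, fun h => ?_⟩, fun R hR => le_sSup hR⟩
    · obtain ⟨R, hR, hyR⟩ := (hmem y).1 hy
      exact (hmem x).2 ⟨R, hR, (hc hR).1 hyR hxy⟩
    · obtain ⟨R, hR, hwR⟩ := (hmem w).1 h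
      exact (hc hR).2 hwR) ⊥ ⟨fun x y hy hxy => by
        rw [Submodule.mem_bot] at hy ⊢
        subst hy
        exact eq_zero_of_abs_le_zero (by simpa [abs] using hxy), by simpa using hw⟩
  refine ⟨P, ⟨hP.prop.1, fun x y hx hy hxy => ?_⟩, hP.prop.2⟩
  by_contra! hcon
  have hmem : ∀ z, 0 ≤ z → z ∉ P → w ∈ idealAdjoin P z := by
    intro z hz hzP
    by_contra hwz
    have hle : P ≤ idealAdjoin P z := fun a ha =>
      ⟨|a|, hP.prop.1 ha (abs_abs a).le, 0, le_rfl, by simp⟩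
    have hC : idealAdjoin P z ∈ 𝒞 :=
      ⟨fun a b ⟨p, hp, r, hr, h⟩ hab => ⟨p, hp, r, hr, hab.trans h⟩, hwz⟩
    exact hzP (hP.le_of_ge hC hle ⟨0, P.zero_mem, 1, zero_le_one, by simp [abs_of_nonneg hz]⟩)
  obtain ⟨p, hp, r, hr, h⟩ := hmem x hx hcon.1
  obtain ⟨q, hq, s, hs, h'⟩ := hmem y hy hcon.2
  have hpq : |p| + |q| ∈ P :=
    P.add_mem (hP.prop.1 hp (abs_abs p).le) (hP.prop.1 hq (abs_abs q).le)
  have hin : (r • x) ⊓ (s • y) = 0 := by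
    refine smul_inf_eq_zero ?_ hx (smul_nonneg hs hy) hr
    rw [inf_comm]
    exact smul_inf_eq_zero (by rwa [inf_comm]) hy hx hs
  refine hP.prop.2 (hP.prop.1 hpq ?_)
  refine le_trans ?_ (le_abs_self _)
  have h1 : |w| ≤ |p| + |q| + r • x := h.trans (add_le_add_left
    ((le_abs_self p).trans (le_add_of_nonneg_right (abs_nonneg q))) _)
  have h2 : |w| ≤ |p| + |q| + s • y := h'.trans (add_le_add_left
    ((le_abs_self q).trans (le_add_of_nonneg_left (abs_nonneg p))) _)
  calc |w| ≤ (|p| + |q| + r • x) ⊓ (|p| + |q| + s • y) := le_inf h1 h2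
    _ = |p| + |q| := by rw [← add_inf, hin, add_zero]

end VectorLattice

/-! ### The order modulo a prime ideal -/

namespace VectorLattice

variable {E : Type*} [AddCommGroup E] [Lattice E] [Module ℝ E]

/-- `a ≤ b` modulo the subspace `P`, that is, up to adding an element of `P`. For a prime ideal `P`
this is the order of the totally ordered quotient `E ⧸ P`. -/
def LeMod (P : Submodule ℝ E) (a b : E) : Prop :=
  ∃ p ∈ P, a ≤ b + p

theorem LeMod.of_le {P : Submodule ℝ E} {a b : E} (h : a ≤ b) : LeMod P a b :=
  ⟨0, P.zero_mem, by simpa using h⟩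

theorem LeMod.smul [IsOrderedModule ℝ E] {P : Submodule ℝ E} {a b : E} (h : LeMod P a b) {r : ℝ}
    (hr : 0 ≤ r) : LeMod P (r • a) (r • b) := by
  obtain ⟨p, hp, h⟩ := h
  refine ⟨r • p, P.smul_mem r hp, ?_⟩
  rw [← smul_add]
  exact smul_le_smul_of_nonneg_left h hr

variable [IsOrderedAddMonoid E]

theorem LeMod.trans {P : Submodule ℝ E} {a b c : E} (h : LeMod P a b) (h' : LeMod P b c) :
    LeMod P a c := by
  obtain ⟨p, hp, h⟩ := h
  obtain ⟨q, hq, h'⟩ := h'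
  refine ⟨q + p, P.add_mem hq hp, h.trans ?_⟩
  rw [← add_assoc]
  exact add_le_add_left h' p

theorem LeMod.add {P : Submodule ℝ E} {a b c d : E} (h : LeMod P a b) (h' : LeMod P c d) :
    LeMod P (a + c) (b + d) := by
  obtain ⟨p, hp, h⟩ := h
  obtain ⟨q, hq, h'⟩ := h'
  refine ⟨p + q, P.add_mem hp hq, (add_le_add h h').trans (le_of_eq ?_)⟩
  abel

theorem LeMod.abs {P : Submodule ℝ E} (hP : IsPrimeIdeal P) {a b : E} (h : LeMod P a b)
    (h' : LeMod P (-a) b) : LeMod P |a| b := by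
  obtain ⟨p, hp, h⟩ := h
  obtain ⟨q, hq, h'⟩ := h'
  refine ⟨|p| + |q|, P.add_mem (hP.solid hp (abs_abs p).le) (hP.solid hq (abs_abs q).le),
    abs_le'.2 ⟨h.trans (add_le_add_right ?_ b), h'.trans (add_le_add_right ?_ b)⟩⟩
  · exact (le_abs_self p).trans (le_add_of_nonneg_right (abs_nonneg q))
  · exact (le_abs_self q).trans (le_add_of_nonneg_left (abs_nonneg p))

theorem IsPrimeIdeal.mem_of_leMod {P : Submodule ℝ E} (hP : IsPrimeIdeal P) {a b : E} (ha : 0 ≤ a)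
    (hb : b ∈ P) (h : LeMod P a b) : a ∈ P := by
  obtain ⟨p, hp, h⟩ := h
  refine hP.solid (P.add_mem hb hp) ?_
  rw [abs_of_nonneg ha]
  exact h.trans (le_abs_self _)

theorem IsPrimeIdeal.mem_of_le {P : Submodule ℝ E} (hP : IsPrimeIdeal P) {a b : E} (ha : 0 ≤ a)
    (hb : b ∈ P) (h : a ≤ b) : a ∈ P :=
  hP.mem_of_leMod ha hb (.of_le h)

theorem IsPrimeIdeal.negPart_mem {P : Submodule ℝ E} (hP : IsPrimeIdeal P) {a : E}
    (h : a⁺ ∉ P) : a⁻ ∈ P :=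
  (hP.prime (posPart_nonneg a) (negPart_nonneg a) (posPart_inf_negPart_eq_zero a)).resolve_left h

theorem IsPrimeIdeal.posPart_mem {P : Submodule ℝ E} (hP : IsPrimeIdeal P) {a : E}
    (h : a⁻ ∉ P) : a⁺ ∈ P :=
  (hP.prime (posPart_nonneg a) (negPart_nonneg a) (posPart_inf_negPart_eq_zero a)).resolve_right h

theorem IsPrimeIdeal.map_mem {P : Submodule ℝ E} (hP : IsPrimeIdeal P) {T : Module.End ℝ E}
    (hT : IsLocal T) {x y : E} (hx : 0 ≤ x) (hy : 0 ≤ y) (h : x ⊓ y = 0) (hyP : y ∉ P) :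
    T x ∈ P :=
  hP.solid ((hP.prime (abs_nonneg (T x)) hy (hT hx hy h)).resolve_right hyP) (abs_abs _).ge

/-- In an Archimedean vector lattice, a positive element `w` vanishes if, modulo every prime ideal
not containing `w`, it is at most `n⁻¹ c` for all `n`. The prime ideal used in the proof is chosen
after `n`, as a prime ideal that does not contain `(w - n⁻¹ c)⁺`: the quotients by prime ideals need
not be Archimedean. -/
theorem eq_zero_of_leMod [IsOrderedModule ℝ E]
    (harch : ∀ a b : E, (∀ n : ℕ, n • a ≤ b) → a ≤ 0) {w c : E} (hw : 0 ≤ w) (hc : 0 ≤ c)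
    (h : ∀ P : Submodule ℝ E, IsPrimeIdeal P → w ∉ P → ∀ n : ℕ, 0 < n →
      LeMod P w ((n : ℝ)⁻¹ • c)) : w = 0 := by
  refine le_antisymm (harch w c fun n => ?_) hw
  rcases Nat.eq_zero_or_pos n with rfl | hn
  · simpa using hc
  suffices hv : (w - (n : ℝ)⁻¹ • c)⁺ = 0 by
    have hn' : (0 : ℝ) < n := by exact_mod_cast hn
    have h1 : w ≤ (n : ℝ)⁻¹ • c := sub_nonpos.1 (posPart_eq_zero.1 hv)
    have h2 := smul_le_smul_of_nonneg_left h1 hn'.le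
    rwa [smul_smul, mul_inv_cancel₀ hn'.ne', one_smul, Nat.cast_smul_eq_nsmul] at h2
  by_contra hv
  obtain ⟨P, hP, hvP⟩ := exists_isPrimeIdeal_notMem hv
  have hwP : w ∉ P := fun hwP => hvP <| hP.mem_of_le (posPart_nonneg _) hwP <|
    sup_le (sub_le_self _ (smul_nonneg (by positivity) hc)) hw
  obtain ⟨p, hp, hle⟩ := h P hP hwP n hn
  refine hvP (hP.solid hp ?_)
  rw [abs_of_nonneg (posPart_nonneg _)]
  exact sup_le ((sub_le_iff_le_add'.2 hle).trans (le_abs_self p)) (abs_nonneg p)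

/-- For `0 ≤ x ≤ e`, the quotient `x / e` lies modulo a prime ideal between `α` and `α + n⁻¹` for
some `α` in `[0, 1]`: the negative part of `x - (i / n) e` belongs to the ideal for `i = 0` and not
for `i = n + 1`, and `α = (i - 1) / n` for the first `i` for which it does not. -/
theorem IsPrimeIdeal.exists_level [IsOrderedModule ℝ E] {P : Submodule ℝ E} (hP : IsPrimeIdeal P)
    {x e : E} (hx : 0 ≤ x) (hxe : x ≤ e) (he : e ∉ P) {n : ℕ} (hn : 0 < n) :
    ∃ α : ℝ, 0 ≤ α ∧ α ≤ 1 ∧ (x - α • e)⁻ ∈ P ∧ (x - α • e - (n : ℝ)⁻¹ • e)⁻ ∉ P := by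
  classical
  have hn' : (0 : ℝ) < n := by exact_mod_cast hn
  have he0 : 0 ≤ e := hx.trans hxe
  have hlast : (x - (((n + 1 : ℕ) : ℝ) * (n : ℝ)⁻¹) • e)⁻ ∉ P := by
    refine fun hmem => he ?_
    have hle : (n : ℝ)⁻¹ • e ≤ (x - (((n + 1 : ℕ) : ℝ) * (n : ℝ)⁻¹) • e)⁻ := by
      refine le_trans ?_ (neg_le_negPart _)
      have h1 : ((n + 1 : ℕ) : ℝ) * (n : ℝ)⁻¹ = 1 + (n : ℝ)⁻¹ := by
        push_cast; field_simp
      rw [h1, add_smul, one_smul, ← sub_nonneg]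
      have h2 : -(x - (e + (n : ℝ)⁻¹ • e)) - (n : ℝ)⁻¹ • e = e - x := by abel
      rw [h2]
      exact sub_nonneg.2 hxe
    have h3 := P.smul_mem (n : ℝ)
      (hP.mem_of_le (smul_nonneg (inv_nonneg.2 hn'.le) he0) hmem hle)
    rwa [smul_smul, mul_inv_cancel₀ hn'.ne', one_smul] at h3
  have hex : ∃ i : ℕ, (x - (i * (n : ℝ)⁻¹) • e)⁻ ∉ P := ⟨n + 1, hlast⟩
  have hi0 : Nat.find hex ≠ 0 := by
    intro h0
    have := Nat.find_spec hex
    rw [h0] at this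
    refine this ?_
    rw [Nat.cast_zero, zero_mul, zero_smul, sub_zero, negPart_of_nonneg hx]
    exact P.zero_mem
  obtain ⟨j, hj⟩ := Nat.exists_eq_succ_of_ne_zero hi0
  have hjP : (x - (j * (n : ℝ)⁻¹) • e)⁻ ∈ P := by
    have := Nat.find_min hex (m := j) (by omega)
    push Not at this
    exact this
  have hjP' : (x - (((j + 1 : ℕ) : ℝ) * (n : ℝ)⁻¹) • e)⁻ ∉ P := by
    have := Nat.find_spec hex
    rwa [hj] at this
  refine ⟨j * (n : ℝ)⁻¹, by positivity, ?_, hjP, ?_⟩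
  · have hle : Nat.find hex ≤ n + 1 := Nat.find_min' hex hlast
    have : (j : ℝ) ≤ n := by exact_mod_cast (by omega : j ≤ n)
    rw [← div_eq_mul_inv]
    exact (div_le_one hn').2 this
  · have h1 : ((j + 1 : ℕ) : ℝ) * (n : ℝ)⁻¹ = j * (n : ℝ)⁻¹ + (n : ℝ)⁻¹ := by push_cast; ring
    rw [h1, add_smul, ← sub_sub] at hjP'
    exact hjP'

/-- A local operator `T` is multiplication by a constant modulo a prime ideal `P`: if `x` is nearly
`α e` modulo `P`, then `T x` is nearly `α T e` modulo `P`. With `z = x - α e` and `d = n⁻¹ e`, the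
operator `T` maps `(z - d)⁺` and `(z + d)⁻` into `P`, because their disjoint partners `(z - d)⁻` and
`(z + d)⁺` are not in `P`; hence `T (z + d)` agrees modulo `P` with the value of `T` at
`(z + d)⁺ - (z - d)⁺`, an element of the order interval from `0` to `2 d`. -/
theorem IsPrimeIdeal.exists_approx [IsOrderedModule ℝ E] {P : Submodule ℝ E} (hP : IsPrimeIdeal P)
    {T : Module.End ℝ E} (hT : IsLocal T) {x e e' : E} (hx : 0 ≤ x) (hxe : x ≤ e) (he : e ∉ P)
    (he' : ∀ f, 0 ≤ f → f ≤ e → |T f| ≤ e') {n : ℕ} (hn : 0 < n) :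
    ∃ α : ℝ, 0 ≤ α ∧ α ≤ 1 ∧ LeMod P |x - α • e| ((n : ℝ)⁻¹ • e) ∧
      LeMod P |T (x - α • e)| ((n : ℝ)⁻¹ • (3 : ℝ) • e') := by
  obtain ⟨α, h0, h1, hz, hz'⟩ := hP.exists_level hx hxe he hn
  refine ⟨α, h0, h1, ?_⟩
  have hn' : (0 : ℝ) < n := by exact_mod_cast hn
  have he0 : 0 ≤ e := hx.trans hxe
  set δ : ℝ := (n : ℝ)⁻¹ with hδ
  have hδ0 : 0 < δ := inv_pos.2 hn'
  set z := x - α • e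
  set d := δ • e with hd
  have hd0 : 0 ≤ d := smul_nonneg hδ0.le he0
  have hdP : d ∉ P := fun h => he (by
    have := P.smul_mem δ⁻¹ h
    rwa [hd, smul_smul, inv_mul_cancel₀ hδ0.ne', one_smul] at this)
  have hf₁ : (z - d)⁺ ∈ P := hP.posPart_mem hz'
  have hTf₁ : T (z - d)⁺ ∈ P := hP.map_mem hT (posPart_nonneg _) (negPart_nonneg _)
    (posPart_inf_negPart_eq_zero _) hz'
  have hf₀ : (z + d)⁺ ∉ P := by
    intro hmem
    refine hdP (hP.mem_of_le hd0 (P.add_mem hmem hz) ?_)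
    calc d = (z + d) + -z := by abel
      _ ≤ _ := add_le_add (le_posPart _) (neg_le_negPart _)
  have hTf₀ : T (z + d)⁻ ∈ P := hP.map_mem hT (negPart_nonneg _) (posPart_nonneg _)
    (by rw [inf_comm]; exact posPart_inf_negPart_eq_zero _) hf₀
  refine ⟨LeMod.abs hP ⟨_, hf₁, ?_⟩ ⟨_, hz, (neg_le_negPart z).trans
    (le_add_of_nonneg_left hd0)⟩, ?_⟩
  · rw [← sub_le_iff_le_add']
    exact le_posPart _
  -- modulo `P`, the value `T (z + d)` is `T g`, where `0 ≤ g ≤ 2 d`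
  set g := (z + d)⁺ - (z - d)⁺ with hg
  have hg0 : 0 ≤ g := sub_nonneg.2 (posPart_mono (sub_le_self z hd0 |>.trans
    (le_add_of_nonneg_right hd0)))
  have hg1 : g ≤ (2 * δ) • e := by
    rw [hg, sub_le_iff_le_add]
    have h2 : (2 * δ) • e = d + d := by rw [hd]; module
    refine sup_le ?_ (add_nonneg (smul_nonneg (by positivity) he0) (posPart_nonneg _))
    calc z + d = (d + d) + (z - d) := by abel
      _ ≤ _ := by rw [h2]; exact add_le_add_right (le_posPart _) _
  have hTg : |T g| ≤ (2 * δ) • e' := by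
    have h2 : 0 < 2 * δ := by positivity
    have h3 := he' ((2 * δ)⁻¹ • g) (smul_nonneg (by positivity) hg0) (by
      have := smul_le_smul_of_nonneg_left hg1 (inv_nonneg.2 h2.le)
      rwa [smul_smul, inv_mul_cancel₀ h2.ne', one_smul] at this)
    have h4 := smul_le_smul_of_nonneg_left h3 h2.le
    rwa [← abs_smul_of_nonneg h2.le, ← map_smul, smul_smul, mul_inv_cancel₀ h2.ne',
      one_smul] at h4
  have hTd : |T d| ≤ δ • e' := by
    rw [hd, map_smul, abs_smul_of_nonneg hδ0.le]
    exact smul_le_smul_of_nonneg_left (he' e he0 le_rfl) hδ0.le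
  have hTz : T z = T g - T d + (T (z - d)⁺ - T (z + d)⁻) := by
    have h2 : z = g - d + ((z - d)⁺ - (z + d)⁻) := by
      have h3 : z = (z + d)⁺ - (z + d)⁻ - d := by rw [posPart_sub_negPart]; abel
      rw [hg]
      nth_rewrite 1 [h3]
      abel
    nth_rewrite 1 [h2]
    simp only [map_add, map_sub]
  have hm : T (z - d)⁺ - T (z + d)⁻ ∈ P := P.sub_mem hTf₁ hTf₀
  have hgd : |T g - T d| ≤ δ • (3 : ℝ) • e' := by
    calc |T g - T d| ≤ |T g| + |T d| := by
          rw [sub_eq_add_neg, ← abs_neg (T d)]; exact abs_add_le _ _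
      _ ≤ (2 * δ) • e' + δ • e' := add_le_add hTg hTd
      _ = δ • (3 : ℝ) • e' := by module
  refine LeMod.abs hP ⟨_, hm, ?_⟩ ⟨_, P.neg_mem hm, ?_⟩
  · nth_rewrite 1 [hTz]
    exact add_le_add_left ((le_abs_self _).trans hgd) _
  · nth_rewrite 1 [hTz]
    rw [neg_add]
    exact add_le_add_left ((neg_le_abs _).trans hgd) _

end VectorLattice

/-! ### Local operators on Archimedean vector lattices -/

namespace VectorLattice

variable {E : Type*} [AddCommGroup E] [Lattice E] [Module ℝ E] [IsOrderedAddMonoid E]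

/-- A bound by a multiple of the identity on the positive cone extends to the whole space. -/
theorem abs_map_le_of_nonneg {T : Module.End ℝ E} {r : ℝ}
    (h : ∀ x, 0 ≤ x → |T x| ≤ r • x) (x : E) : |T x| ≤ r • |x| := by
  calc |T x| = |T x⁺ + -T x⁻| := by
        rw [← sub_eq_add_neg, ← map_sub, posPart_sub_negPart]
    _ ≤ |T x⁺| + |T x⁻| := by rw [← abs_neg (T x⁻)]; exact abs_add_le _ _
    _ ≤ r • x⁺ + r • x⁻ := add_le_add (h _ (posPart_nonneg x)) (h _ (negPart_nonneg x))
    _ = r • |x| := by rw [← smul_add, posPart_add_negPart]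

variable [IsOrderedModule ℝ E]

/-- If `T` is multiplication by a function `t`, then `u = (|t x| - r x)⁺` is supported where
`|t| ≥ r`; this is the corresponding inequality for order bounded local operators. Put `e = x + u`
and let `w` be the positive part of `r u - |T u|`. Modulo a prime ideal that does not contain `w`,
both `|T x| - r x` and `r u - |T u|` are positive, whereas `z = (1 - α) x - α u` and `T z` are small
for some `α`; so `(1 - α) u + α w ≤ |T z| + r |z|` is small, and with it `w`. -/
theorem smul_le_abs_map_posPart (harch : ∀ a b : E, (∀ n : ℕ, n • a ≤ b) → a ≤ 0)
    {T : Module.End ℝ E} (hT : IsLocal T) (hTb : IsOrderBoundedOp T) {r : ℝ} (hr : 0 ≤ r)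
    {x : E} (hx : 0 ≤ x) :
    r • (|T x| - r • x)⁺ ≤ |T (|T x| - r • x)⁺| := by
  set k := |T x| - r • x with hk
  set u := k⁺ with hu
  have hu0 : 0 ≤ u := posPart_nonneg k
  set l := r • u - |T u| with hl
  have hwu : l⁺ ≤ r • u := sup_le (sub_le_self _ (abs_nonneg _)) (smul_nonneg hr hu0)
  have hw0 : 0 ≤ l⁺ := posPart_nonneg l
  rw [← sub_nonpos, ← hl, ← posPart_eq_zero]
  have hxe : x ≤ x + u := le_add_of_nonneg_right hu0
  have hue : u ≤ x + u := le_add_of_nonneg_left hx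
  have he0 : 0 ≤ x + u := add_nonneg hx hu0
  obtain ⟨c, d, hcd⟩ := hTb 0 (x + u)
  have he' : ∀ f, 0 ≤ f → f ≤ x + u → |T f| ≤ |c| + |d| := by
    intro f hf hfe
    obtain ⟨h1, h2⟩ := hcd f ⟨hf, hfe⟩
    exact abs_le'.2 ⟨(h2.trans (le_abs_self d)).trans (le_add_of_nonneg_left (abs_nonneg c)),
      ((neg_le_neg h1).trans (neg_le_abs c)).trans (le_add_of_nonneg_right (abs_nonneg d))⟩
  set e := x + u with he
  set e' := |c| + |d| with hee'
  have he'0 : 0 ≤ e' := add_nonneg (abs_nonneg c) (abs_nonneg d)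
  refine eq_zero_of_leMod (c := (1 + r) • ((3 : ℝ) • e' + r • e)) harch hw0
    (smul_nonneg (by positivity) (add_nonneg (smul_nonneg (by norm_num) he'0)
      (smul_nonneg hr he0))) fun P hP hwP n hn => ?_
  have huP : u ∉ P := fun h => hwP (hP.mem_of_le hw0 (P.smul_mem r h) hwu)
  have heP : e ∉ P := fun h => huP (hP.mem_of_le hu0 h hue)
  obtain ⟨α, hα0, hα1, hz, hTz⟩ := hP.exists_approx hT hx hxe heP he' hn
  have hα1' : 0 ≤ 1 - α := sub_nonneg.2 hα1
  set z := x - α • e with hzdef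
  have hz' : z = (1 - α) • x - α • u := by rw [hzdef, he]; module
  have hm : (1 - α) • k⁻ + α • l⁻ ∈ P :=
    P.add_mem (P.smul_mem _ (hP.negPart_mem huP)) (P.smul_mem _ (hP.negPart_mem hwP))
  have h1 : LeMod P ((1 - α) • u + α • l⁺) (|T z| + r • |z|) := by
    refine ⟨_, hm, ?_⟩
    have e1 : (1 - α) • u + α • l⁺ =
        (1 - α) • k + α • l + ((1 - α) • k⁻ + α • l⁻) := by
      rw [hu, eq_add_of_sub_eq (posPart_sub_negPart k), eq_add_of_sub_eq (posPart_sub_negPart l)]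
      module
    rw [e1]
    refine add_le_add_left ?_ _
    have e2 : (1 - α) • k + α • l = ((1 - α) • |T x| - α • |T u|) + r • (-z) := by
      rw [hk, hl, hz']; module
    rw [e2]
    refine add_le_add ?_ (smul_le_smul_of_nonneg_left (neg_le_abs z) hr)
    rw [← abs_smul_of_nonneg hα1', ← abs_smul_of_nonneg hα0, sub_le_iff_le_add]
    have e3 : (1 - α) • T x = T z + α • T u := by
      rw [hz', map_sub, map_smul, map_smul]; abel
    rw [e3]
    exact abs_add_le _ _
  have h2 : LeMod P ((1 - α) • u + α • l⁺) ((n : ℝ)⁻¹ • ((3 : ℝ) • e' + r • e)) := by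
    refine (h1.trans (hTz.add (hz.smul hr))).trans (.of_le (le_of_eq ?_))
    module
  have h3 : l⁺ ≤ (1 + r) • ((1 - α) • u + α • l⁺) := by
    rw [← sub_nonneg]
    have e4 : (1 + r) • ((1 - α) • u + α • l⁺) - l⁺ =
        (1 - α) • u + (1 - α) • (r • u - l⁺) + (r * α) • l⁺ := by module
    rw [e4]
    exact add_nonneg (add_nonneg (smul_nonneg hα1' hu0) (smul_nonneg hα1' (sub_nonneg.2 hwu)))
      (smul_nonneg (by positivity) hw0)
  refine ((LeMod.of_le h3).trans (h2.smul (by positivity : (0 : ℝ) ≤ 1 + r))).trans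
    (.of_le (le_of_eq ?_))
  module

/-- The values of a local operator at two positive elements do not have opposite signs: where
`T x > 0 > T y`, the value of `T` at `(1 - α) x - α y` is at least the smaller of `T x` and `-T y`,
whatever `α` in `[0, 1]`, and it is nearly zero for some `α`. -/
theorem posPart_map_inf_negPart_map (harch : ∀ a b : E, (∀ n : ℕ, n • a ≤ b) → a ≤ 0)
    {T : Module.End ℝ E} (hT : IsLocal T) {M : ℝ} (hM : 0 ≤ M)
    (hTM : ∀ x, 0 ≤ x → |T x| ≤ M • x) {x y : E} (hx : 0 ≤ x) (hy : 0 ≤ y) :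
    (T x)⁺ ⊓ (T y)⁻ = 0 := by
  have hw0 : 0 ≤ (T x)⁺ ⊓ (T y)⁻ := le_inf (posPart_nonneg _) (negPart_nonneg _)
  set w := (T x)⁺ ⊓ (T y)⁻ with hw
  have hxe : x ≤ x + y := le_add_of_nonneg_right hy
  have he0 : 0 ≤ x + y := add_nonneg hx hy
  set e := x + y with he
  refine eq_zero_of_leMod (c := (3 : ℝ) • M • e) harch hw0
    (smul_nonneg (by norm_num) (smul_nonneg hM he0)) fun P hP hwP n hn => ?_
  have hxP : (T x)⁺ ∉ P := fun h => hwP (hP.mem_of_le hw0 h inf_le_left)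
  have hyP : (T y)⁻ ∉ P := fun h => hwP (hP.mem_of_le hw0 h inf_le_right)
  have heP : e ∉ P := by
    refine fun h => hxP (hP.mem_of_le (posPart_nonneg _) (P.smul_mem M h) ?_)
    refine (le_trans ?_ (hTM x hx)).trans (smul_le_smul_of_nonneg_left hxe hM)
    exact sup_le (le_abs_self _) (abs_nonneg _)
  obtain ⟨α, hα0, hα1, -, hTz⟩ := hP.exists_approx hT hx hxe heP (e' := M • e)
    (fun f hf hfe => (hTM f hf).trans (smul_le_smul_of_nonneg_left hfe hM)) hn
  have hα1' : 0 ≤ 1 - α := sub_nonneg.2 hα1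
  have hm : (1 - α) • (T x)⁻ + α • (T y)⁺ ∈ P :=
    P.add_mem (P.smul_mem _ (hP.negPart_mem hxP)) (P.smul_mem _ (hP.posPart_mem hyP))
  refine LeMod.trans ⟨_, hm, ?_⟩ hTz
  have e1 : x - α • e = (1 - α) • x - α • y := by rw [he]; module
  have e2 : (1 - α) • (T x)⁺ + α • (T y)⁻ =
      T (x - α • e) + ((1 - α) • (T x)⁻ + α • (T y)⁺) := by
    rw [e1, map_sub, map_smul, map_smul, eq_add_of_sub_eq (posPart_sub_negPart (T x))]
    have e3 : (T y)⁺ = T y + (T y)⁻ := eq_add_of_sub_eq (posPart_sub_negPart (T y))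
    rw [e3]
    module
  calc w = (1 - α) • w + α • w := by module
    _ ≤ (1 - α) • (T x)⁺ + α • (T y)⁻ :=
      add_le_add (smul_le_smul_of_nonneg_left inf_le_left hα1')
        (smul_le_smul_of_nonneg_left inf_le_right hα0)
    _ ≤ _ := by rw [e2]; exact add_le_add_left (le_abs_self _) _

/-- A map on the positive cone that is additive and positively homogeneous extends to a linear
operator. -/
theorem exists_linearMap_extending (f : E → E)
    (hadd : ∀ x y, 0 ≤ x → 0 ≤ y → f (x + y) = f x + f y)
    (hsmul : ∀ (r : ℝ) x, 0 ≤ r → 0 ≤ x → f (r • x) = r • f x) :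
    ∃ A : Module.End ℝ E, ∀ x, 0 ≤ x → A x = f x := by
  have key : ∀ a b c d : E, 0 ≤ a → 0 ≤ b → 0 ≤ c → 0 ≤ d → a - b = c - d →
      f a - f b = f c - f d := by
    intro a b c d ha hb hc hd h
    rw [sub_eq_sub_iff_add_eq_add] at h ⊢
    rw [← hadd a d ha hd, ← hadd c b hc hb, h]
  have hpm : ∀ a b : E, 0 ≤ a → 0 ≤ b → f (a - b)⁺ - f (a - b)⁻ = f a - f b := fun a b ha hb =>
    key _ _ _ _ (posPart_nonneg _) (negPart_nonneg _) ha hb (posPart_sub_negPart _)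
  refine ⟨{ toFun := fun x => f x⁺ - f x⁻, map_add' := fun x y => ?_, map_smul' := fun r x => ?_ },
    fun x hx => ?_⟩
  · have h : x + y = (x⁺ + y⁺) - (x⁻ + y⁻) := by
      rw [eq_add_of_sub_eq (posPart_sub_negPart x), eq_add_of_sub_eq (posPart_sub_negPart y)]
      abel
    rw [h, hpm _ _ (add_nonneg (posPart_nonneg x) (posPart_nonneg y))
      (add_nonneg (negPart_nonneg x) (negPart_nonneg y)),
      hadd _ _ (posPart_nonneg x) (posPart_nonneg y),
      hadd _ _ (negPart_nonneg x) (negPart_nonneg y)]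
    abel
  · have h0 : r • x = r • x⁺ - r • x⁻ := by rw [← smul_sub, posPart_sub_negPart]
    simp only [RingHom.id_apply]
    rcases le_total 0 r with hr | hr
    · rw [h0, hpm _ _ (smul_nonneg hr (posPart_nonneg x)) (smul_nonneg hr (negPart_nonneg x)),
        hsmul _ _ hr (posPart_nonneg x), hsmul _ _ hr (negPart_nonneg x), smul_sub]
    · have hr' : 0 ≤ -r := neg_nonneg.2 hr
      have h1 : r • x = (-r) • x⁻ - (-r) • x⁺ := by rw [h0]; module
      rw [h1, hpm _ _ (smul_nonneg hr' (negPart_nonneg x)) (smul_nonneg hr' (posPart_nonneg x)),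
        hsmul _ _ hr' (posPart_nonneg x), hsmul _ _ hr' (negPart_nonneg x)]
      module
  · have h0 : f 0 = 0 := by simpa using hadd 0 0 le_rfl le_rfl
    change f x⁺ - f x⁻ = f x
    rw [posPart_of_nonneg hx, negPart_of_nonneg hx, h0, sub_zero]

end VectorLattice

/-! ### Orthomorphisms of vector lattices -/

namespace Orth

open VectorLattice

section Order

variable {E : Type*} [AddCommGroup E] [Lattice E] [Module ℝ E] [IsOrderedAddMonoid E]
  [IsOrderedModule ℝ E]

theorem isLocal (T : Orth E) : IsLocal (T : Module.End ℝ E) := T.2.2.isLocal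

/-- Operators bounded by a multiple of the identity are orthomorphisms. -/
theorem mem_of_abs_le {T : Module.End ℝ E} {r : ℝ} (hr : 0 ≤ r) (h : ∀ x, |T x| ≤ r • |x|) :
    T ∈ Orth E := by
  refine ⟨fun a b => ⟨-(r • (|a| + |b|)), r • (|a| + |b|), fun x hx => ?_⟩,
    fun B hB x hx => hB.solid (B.smul_mem r hx) ?_⟩
  · have h1 : |x| ≤ |a| + |b| := abs_le'.2
      ⟨(hx.2.trans (le_abs_self b)).trans (le_add_of_nonneg_left (abs_nonneg a)),
        ((neg_le_neg hx.1).trans (neg_le_abs a)).trans (le_add_of_nonneg_right (abs_nonneg b))⟩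
    have h2 := (h x).trans (smul_le_smul_of_nonneg_left h1 hr)
    exact ⟨neg_le.1 ((neg_le_abs _).trans h2), (le_abs_self _).trans h2⟩
  · rw [abs_smul_of_nonneg hr]
    exact h x

instance instIsOrderedAddMonoid : IsOrderedAddMonoid (Orth E) where
  add_le_add_left _ _ h U x hx := add_le_add_left (h x hx) ((U : Module.End ℝ E) x)

theorem isLUB_modulus {T A : Orth E}
    (hA : ∀ x : E, 0 ≤ x → (A : Module.End ℝ E) x = |(T : Module.End ℝ E) x|) :
    IsLUB {T, -T} A := by
  constructor
  · rintro S (rfl | rfl) x hx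
    · rw [hA x hx]; exact le_abs_self _
    · rw [hA x hx]; exact neg_le_abs _
  · intro U hU x hx
    rw [hA x hx]
    exact abs_le'.2 ⟨hU (Set.mem_insert _ _) x hx, hU (Set.mem_insert_of_mem _ rfl) x hx⟩

/-- Positive disjoint orthomorphisms have product zero: `U (V x)` is both disjoint from `U x`, as
`V x` is, and bounded by a multiple of `U x`, as `V x` is bounded by a multiple of `x`. -/
theorem mul_eq_zero_of_inf_eq_zero {U V : Orth E} (hU : 0 ≤ U) (hV : 0 ≤ V)
    {r : ℝ} (hr : 0 ≤ r) (hVr : V ≤ r • (1 : Orth E))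
    (h : ∀ x : E, 0 ≤ x → (U : Module.End ℝ E) x ⊓ (V : Module.End ℝ E) x = 0) : U * V = 0 := by
  have key : ∀ x : E, 0 ≤ x → (U : Module.End ℝ E) ((V : Module.End ℝ E) x) = 0 := by
    intro x hx
    have hux : 0 ≤ (U : Module.End ℝ E) x := hU x hx
    have hvx : 0 ≤ (V : Module.End ℝ E) x := hV x hx
    have huv : 0 ≤ (U : Module.End ℝ E) ((V : Module.End ℝ E) x) := hU _ hvx
    have h1 := isLocal U hvx hux (by rw [inf_comm]; exact h x hx)
    rw [abs_of_nonneg huv, inf_comm] at h1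
    have h2 := smul_inf_eq_zero h1 hux huv hr
    have h3 : (U : Module.End ℝ E) ((V : Module.End ℝ E) x) ≤ r • (U : Module.End ℝ E) x := by
      have h4 : 0 ≤ (U : Module.End ℝ E) (_ - _) := hU _ (sub_nonneg.2 (hVr x hx))
      have h5 : (U : Module.End ℝ E) (((r • (1 : Orth E) : Orth E) : Module.End ℝ E) x) =
          r • (U : Module.End ℝ E) x := (U : Module.End ℝ E).map_smul r x
      rw [map_sub, h5] at h4
      exact sub_nonneg.1 h4
    rwa [inf_eq_right.2 h3] at h2
  exact le_antisymm (fun x hx => (key x hx).le) (fun x hx => (key x hx).ge)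

/-- The modulus `A` of an orthomorphism `T` satisfies `A² = T²`: the products of `A + T` and
`A - T`, in either order, vanish. -/
theorem modulus_mul_self {T A : Orth E} {r : ℝ} (hr : 0 ≤ r) (hTr : T ≤ r • (1 : Orth E))
    (hTr' : -(r • (1 : Orth E)) ≤ T)
    (hA : ∀ x : E, 0 ≤ x → (A : Module.End ℝ E) x = |(T : Module.End ℝ E) x|) :
    A * A = T * T := by
  have hAT := isLUB_modulus hA
  have hT1 : T ≤ A := hAT.1 (Set.mem_insert _ _)
  have hT2 : -T ≤ A := hAT.1 (Set.mem_insert_of_mem _ rfl)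
  have hAr : A ≤ r • (1 : Orth E) := hAT.2 (by
    rintro S (rfl | rfl)
    · exact hTr
    · exact neg_le.1 hTr')
  have hU : 0 ≤ A + T := by simpa using add_le_add_left hT2 T
  have hV : 0 ≤ A - T := sub_nonneg.2 hT1
  have hUr : A + T ≤ (2 * r) • (1 : Orth E) := by
    rw [two_mul, add_smul]; exact add_le_add hAr hTr
  have hVr : A - T ≤ (2 * r) • (1 : Orth E) := by
    rw [two_mul, add_smul, sub_eq_add_neg]; exact add_le_add hAr (neg_le.1 hTr')
  have hdisj : ∀ x : E, 0 ≤ x →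
      ((A + T : Orth E) : Module.End ℝ E) x ⊓ ((A - T : Orth E) : Module.End ℝ E) x = 0 := by
    intro x hx
    have e1 : ((A + T : Orth E) : Module.End ℝ E) x = (2 : ℝ) • ((T : Module.End ℝ E) x)⁺ := by
      change (A : Module.End ℝ E) x + (T : Module.End ℝ E) x = _
      rw [hA x hx, abs_add_eq_two_nsmul_posPart, ← Nat.cast_smul_eq_nsmul ℝ, Nat.cast_ofNat]
    have e2 : ((A - T : Orth E) : Module.End ℝ E) x = (2 : ℝ) • ((T : Module.End ℝ E) x)⁻ := by
      change (A : Module.End ℝ E) x - (T : Module.End ℝ E) x = _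
      rw [hA x hx, abs_sub_eq_two_nsmul_negPart, ← Nat.cast_smul_eq_nsmul ℝ, Nat.cast_ofNat]
    rw [e1, e2, ← smul_inf zero_le_two, posPart_inf_negPart_eq_zero, smul_zero]
  have h2r : 0 ≤ 2 * r := by positivity
  have h1 := mul_eq_zero_of_inf_eq_zero hU hV h2r hVr hdisj
  have h2 := mul_eq_zero_of_inf_eq_zero hV hU h2r hUr
    (fun x hx => by rw [inf_comm]; exact hdisj x hx)
  rw [add_mul, mul_sub, mul_sub] at h1
  rw [sub_mul, mul_add, mul_add] at h2
  have h3 : (2 : ℝ) • (A * A - T * T) = 0 := by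
    rw [two_smul]
    calc _ = (A * A - A * T + (T * A - T * T)) + (A * A + A * T - (T * A + T * T)) := by abel
      _ = 0 := by rw [h1, h2, add_zero]
  exact sub_eq_zero.1 ((smul_eq_zero.1 h3).resolve_left two_ne_zero)

end Order

/-! ### Orthomorphisms of Banach lattices -/

section Banach

variable {E : Type*} [NormedAddCommGroup E] [NormedSpace ℝ E] [Lattice E] [IsOrderedAddMonoid E]
  [HasSolidNorm E] [IsOrderedModule ℝ E]

theorem _root_.VectorLattice.archimedean_of_hasSolidNorm
    (a b : E) (h : ∀ n : ℕ, n • a ≤ b) : a ≤ 0 := by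
  have hlim : Filter.Tendsto (fun n : ℕ => (1 / ((n : ℝ) + 1)) • b) Filter.atTop (nhds 0) := by
    simpa using (tendsto_one_div_add_atTop_nhds_zero_nat (𝕜 := ℝ)).smul_const b
  refine ge_of_tendsto' hlim fun n => ?_
  have hn : (0 : ℝ) < (n : ℝ) + 1 := by positivity
  have h1 := h (n + 1)
  rw [← Nat.cast_smul_eq_nsmul ℝ, Nat.cast_add, Nat.cast_one] at h1
  have h2 := smul_le_smul_of_nonneg_left h1 (one_div_pos.2 hn).le
  rwa [smul_smul, one_div_mul_cancel hn.ne', one_smul] at h2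

variable [CompleteSpace E]

theorem norm_apply_le (T : Orth E) (x : E) : ‖(T : Module.End ℝ E) x‖ ≤ ‖T‖ * ‖x‖ :=
  (Orth.toCLM T).le_opNorm x

/-- An orthomorphism of a Banach lattice is bounded by its operator norm, as a multiple of the
identity. If `r > ‖T‖`, then `u = (|T x| - r x)⁺` satisfies `r u ≤ |T u|`, so that `u = 0`. -/
theorem abs_apply_le (T : Orth E) (x : E) : |(T : Module.End ℝ E) x| ≤ ‖T‖ • |x| := by
  refine abs_map_le_of_nonneg (fun y hy => ?_) x
  have hlt : ∀ r ∈ Set.Ioi ‖T‖, |(T : Module.End ℝ E) y| ≤ r • y := by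
    intro r hr
    have hr' : ‖T‖ < r := hr
    have hr0 : 0 ≤ r := (norm_nonneg T).trans hr'.le
    set u := (|(T : Module.End ℝ E) y| - r • y)⁺ with hu
    have h1 : r • u ≤ |(T : Module.End ℝ E) u| :=
      smul_le_abs_map_posPart archimedean_of_hasSolidNorm (isLocal T) T.2.1 hr0 hy
    have h2 : r * ‖u‖ ≤ ‖T‖ * ‖u‖ := by
      refine le_trans ?_ (norm_apply_le T u)
      rw [← Real.norm_of_nonneg hr0, ← norm_smul]
      refine norm_le_norm_of_abs_le_abs ?_
      rwa [abs_of_nonneg (smul_nonneg hr0 (posPart_nonneg _))]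
    have h3 : ‖u‖ = 0 := by
      by_contra hne
      have := lt_of_le_of_ne (norm_nonneg u) (Ne.symm hne)
      exact absurd (le_of_mul_le_mul_right h2 this) (not_le.2 hr')
    rw [← sub_nonpos, ← posPart_eq_zero]
    exact norm_eq_zero.1 h3
  have hcl : IsClosed {r : ℝ | |(T : Module.End ℝ E) y| ≤ r • y} :=
    isClosed_le continuous_const (continuous_id.smul continuous_const)
  have hmem : ‖T‖ ∈ closure (Set.Ioi ‖T‖) := by rw [closure_Ioi]; exact Set.self_mem_Ici
  exact hcl.closure_subset_iff.2 hlt hmem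

theorem abs_apply_le_of_nonneg (T : Orth E) {x : E} (hx : 0 ≤ x) :
    |(T : Module.End ℝ E) x| ≤ ‖T‖ • x := by
  simpa [abs_of_nonneg hx] using abs_apply_le T x

theorem norm_le_iff {r : ℝ} (hr : 0 ≤ r) (T : Orth E) :
    ‖T‖ ≤ r ↔ -(r • (1 : Orth E)) ≤ T ∧ T ≤ r • (1 : Orth E) := by
  constructor
  · intro h
    have key : ∀ x : E, 0 ≤ x → |(T : Module.End ℝ E) x| ≤ r • x := fun x hx =>
      (abs_apply_le_of_nonneg T hx).trans (smul_le_smul_of_nonneg_right h hx)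
    exact ⟨fun x hx => neg_le.1 ((neg_le_abs _).trans (key x hx)),
      fun x hx => (le_abs_self _).trans (key x hx)⟩
  · rintro ⟨h1, h2⟩
    refine (Orth.toCLM T).opNorm_le_bound hr fun x => ?_
    have key := abs_map_le_of_nonneg (T := (T : Module.End ℝ E)) (r := r)
      (fun x hx => abs_le'.2 ⟨h2 x hx, neg_le.1 (h1 x hx)⟩) x
    rw [← Real.norm_of_nonneg hr, ← norm_smul]
    refine norm_le_norm_of_abs_le_abs ?_
    rw [abs_smul_of_nonneg hr]
    exact key

theorem isometry_toCLM : Isometry (Orth.toCLM : Orth E → (E →L[ℝ] E)) :=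
  AddMonoidHomClass.isometry_of_norm Orth.toCLM fun _ => rfl

instance instCompleteSpace : CompleteSpace (Orth E) := by
  rw [completeSpace_iff_isComplete_range isometry_toCLM.isUniformInducing]
  have hrange : Set.range (Orth.toCLM : Orth E → (E →L[ℝ] E)) =
      ⋂ x : E, {T | |T x| ≤ ‖T‖ • |x|} := by
    ext T
    simp only [Set.mem_range, Set.mem_iInter, Set.mem_ofPred_eq]
    constructor
    · rintro ⟨T, rfl⟩ x
      exact abs_apply_le T x
    · intro h
      exact ⟨⟨T, mem_of_abs_le (norm_nonneg T) h⟩, rfl⟩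
  rw [hrange]
  refine (isClosed_iInter fun x => ?_).isComplete
  have hev : Continuous fun T : E →L[ℝ] E => T x := (ContinuousLinearMap.apply ℝ E x).continuous
  refine isClosed_le ?_ (continuous_norm.smul continuous_const)
  exact hev.sup hev.neg

/-- The modulus of an orthomorphism `T` exists and is given by `|T| x = |T x|` for `x ≥ 0`. -/
theorem exists_modulus (T : Orth E) :
    ∃ A : Orth E, ∀ x : E, 0 ≤ x → (A : Module.End ℝ E) x = |(T : Module.End ℝ E) x| := by
  have hdisj : ∀ x y : E, 0 ≤ x → 0 ≤ y →
      ((T : Module.End ℝ E) x)⁺ ⊓ ((T : Module.End ℝ E) y)⁻ = 0 := fun x y hx hy =>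
    posPart_map_inf_negPart_map archimedean_of_hasSolidNorm (isLocal T) (norm_nonneg T)
      (fun _ hz => abs_apply_le_of_nonneg T hz) hx hy
  obtain ⟨A, hA⟩ := exists_linearMap_extending (fun x => |(T : Module.End ℝ E) x|)
    (fun x y hx hy => by
      rw [map_add]
      exact abs_add_of_inf_eq_zero (hdisj x y hx hy) (hdisj y x hy hx))
    (fun r x hr _ => by rw [map_smul, abs_smul_of_nonneg hr])
  refine ⟨⟨A, mem_of_abs_le (norm_nonneg T) (abs_map_le_of_nonneg fun x hx => ?_)⟩, hA⟩
  rw [hA x hx, abs_abs]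
  exact abs_apply_le_of_nonneg T hx

end Banach

end Orth

/-! ### Ordered normed algebras whose unit is a strong order unit -/

/-- An Archimedean ordered normed algebra whose closed unit ball is the order interval from `-1` to
`1`, and in which products of positive elements are positive. -/
structure IsUnitOrderedAlgebra (A : Type*) [NormedRing A] [NormedAlgebra ℝ A] [PartialOrder A] :
    Prop where
  add_le_add_left : ∀ a b c : A, a ≤ b → c + a ≤ c + b
  smul_nonneg : ∀ (r : ℝ) (a : A), 0 ≤ r → 0 ≤ a → 0 ≤ r • a
  mul_nonneg : ∀ a b : A, 0 ≤ a → 0 ≤ b → 0 ≤ a * b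
  archimedean : ∀ a b : A, (∀ n : ℕ, n • a ≤ b) → a ≤ 0
  one_nonneg : (0 : A) ≤ 1
  norm_le_iff : ∀ (r : ℝ) (a : A), 0 ≤ r → (‖a‖ ≤ r ↔ -(r • (1 : A)) ≤ a ∧ a ≤ r • (1 : A))

namespace IsUnitOrderedAlgebra

variable {A : Type*} [NormedRing A] [NormedAlgebra ℝ A] [PartialOrder A]
  (hA : IsUnitOrderedAlgebra A)
include hA

theorem isOrderedAddMonoid : IsOrderedAddMonoid A where
  add_le_add_left a b h c := by
    rw [add_comm a, add_comm b]
    exact hA.add_le_add_left a b c h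

theorem smul_le_smul {r : ℝ} (hr : 0 ≤ r) {a b : A} (h : a ≤ b) : r • a ≤ r • b := by
  have := hA.isOrderedAddMonoid
  rw [← sub_nonneg, ← smul_sub]
  exact hA.smul_nonneg r _ hr (sub_nonneg.2 h)

theorem isStrongOrderUnit : IsStrongOrderUnit (1 : A) :=
  ⟨hA.one_nonneg, fun a => ⟨‖a‖, norm_nonneg a, (hA.norm_le_iff _ a (norm_nonneg a)).1 le_rfl⟩⟩

theorem norm_eq_orderUnitNorm (a : A) : ‖a‖ = orderUnitNorm 1 a := by
  have h : {r : ℝ | 0 ≤ r ∧ -(r • (1 : A)) ≤ a ∧ a ≤ r • (1 : A)} = Set.Ici ‖a‖ := by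
    ext r
    constructor
    · rintro ⟨hr, h⟩
      exact (hA.norm_le_iff r a hr).2 h
    · intro h
      have hr : 0 ≤ r := (norm_nonneg a).trans h
      exact ⟨hr, (hA.norm_le_iff r a hr).1 h⟩
  rw [orderUnitNorm, h, csInf_Ici]

theorem isGLB_zero_of_le {a b d : A} (h : IsGLB {a, b} 0) {r : ℝ} (hr : 1 ≤ r) (hd : 0 ≤ d)
    (hda : d ≤ r • a) : IsGLB {d, b} 0 := by
  have := hA.isOrderedAddMonoid
  have ha0 : 0 ≤ a := h.1 (Set.mem_insert _ _)
  have hb0 : 0 ≤ b := h.1 (Set.mem_insert_of_mem _ rfl)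
  have hr0 : 0 < r := zero_lt_one.trans_le hr
  have hbr : b ≤ r • b := by
    rw [← sub_nonneg]
    have e : r • b - b = (r - 1) • b := by module
    rw [e]
    exact hA.smul_nonneg _ _ (sub_nonneg.2 hr) hb0
  refine ⟨?_, fun c hc => ?_⟩
  · rintro x (rfl | rfl)
    · exact hd
    · exact hb0
  · have hcd : c ≤ d := hc (Set.mem_insert _ _)
    have hcb : c ≤ b := hc (Set.mem_insert_of_mem _ rfl)
    have hinv : ∀ x : A, c ≤ r • x → r⁻¹ • c ≤ x := fun x hx => by
      have := hA.smul_le_smul (inv_nonneg.2 hr0.le) hx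
      rwa [smul_smul, inv_mul_cancel₀ hr0.ne', one_smul] at this
    have h1 : r⁻¹ • c ≤ 0 := h.2 (by
      rintro x (rfl | rfl)
      · exact hinv _ (hcd.trans hda)
      · exact hinv _ (hcb.trans hbr))
    have h2 := hA.smul_le_smul hr0.le h1
    rwa [smul_smul, mul_inv_cancel₀ hr0.ne', one_smul, smul_zero] at h2

theorem le_norm_add_one_smul (c : A) : c ≤ (‖c‖ + 1) • (1 : A) :=
  ((hA.norm_le_iff (‖c‖ + 1) c (by positivity)).1 (by linarith)).2

/-- Multiplication by `c ≥ 0` is dominated by multiplication by the scalar `‖c‖ + 1`, and so it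
preserves disjointness; the lattice norm property holds as `‖a‖` is the order unit norm. -/
theorem isBanachFAlgebra [CompleteSpace A] (hsup : ∀ a b : A, ∃ s, IsLUB {a, b} s) :
    IsBanachFAlgebra A := by
  have := hA.isOrderedAddMonoid
  refine
    { add_le_add_left := hA.add_le_add_left
      smul_nonneg := hA.smul_nonneg
      mul_nonneg := hA.mul_nonneg
      archimedean := hA.archimedean
      exists_isLUB := hsup
      exists_isGLB := fun a b => ?_
      isGLB_mul_right := fun a b c h hc => ?_
      isGLB_mul_left := fun a b c h hc => ?_
      complete := inferInstance
      solid := fun a b a' b' ha hb hab => ?_ }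
  · obtain ⟨s, hs⟩ := hsup (-a) (-b)
    refine ⟨-s, ?_⟩
    have := hs.neg
    simpa using this
  · have ha0 : 0 ≤ a := h.1 (Set.mem_insert _ _)
    refine hA.isGLB_zero_of_le h (r := ‖c‖ + 1) (by simp) (hA.mul_nonneg a c ha0 hc) ?_
    have := hA.mul_nonneg _ _ ha0 (sub_nonneg.2 (hA.le_norm_add_one_smul c))
    rwa [mul_sub, mul_smul_comm, mul_one, sub_nonneg] at this
  · have ha0 : 0 ≤ a := h.1 (Set.mem_insert _ _)
    refine hA.isGLB_zero_of_le h (r := ‖c‖ + 1) (by simp) (hA.mul_nonneg c a hc ha0) ?_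
    have := hA.mul_nonneg _ _ (sub_nonneg.2 (hA.le_norm_add_one_smul c)) ha0
    rwa [sub_mul, smul_mul_assoc, one_mul, sub_nonneg] at this
  · obtain ⟨h1, h2⟩ := (hA.norm_le_iff _ b (norm_nonneg b)).1 le_rfl
    have hb' : b' ≤ ‖b‖ • (1 : A) := hb.2 (by
      rintro x (rfl | rfl)
      · exact h2
      · exact neg_le.1 h1)
    have ha' := hab.trans hb'
    refine (hA.norm_le_iff _ a (norm_nonneg b)).2 ⟨neg_le.1 ?_, ?_⟩
    · exact (ha.1 (Set.mem_insert_of_mem _ rfl)).trans ha'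
    · exact (ha.1 (Set.mem_insert _ _)).trans ha'

theorem subalgebra (B : Subalgebra ℝ A) : IsUnitOrderedAlgebra B where
  add_le_add_left a b c h := hA.add_le_add_left (a : A) b c h
  smul_nonneg r a hr ha := hA.smul_nonneg r (a : A) hr ha
  mul_nonneg a b ha hb := hA.mul_nonneg (a : A) b ha hb
  archimedean a b h := hA.archimedean (a : A) b h
  one_nonneg := hA.one_nonneg
  norm_le_iff r a hr := hA.norm_le_iff r (a : A) hr

/-- The identity `a ∨ b = (a + b + |a - b|) / 2`. -/
theorem isLUB_pair {a b m : A} (h : IsLUB {a - b, -(a - b)} m) :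
    IsLUB {a, b} ((1 / 2 : ℝ) • (a + b + m)) := by
  have := hA.isOrderedAddMonoid
  have h2 : (0 : ℝ) ≤ 1 / 2 := by norm_num
  have hm1 : a - b ≤ m := h.1 (Set.mem_insert _ _)
  have hm2 : -(a - b) ≤ m := h.1 (Set.mem_insert_of_mem _ rfl)
  constructor
  · rintro x (rfl | rfl)
    · rw [← sub_nonneg]
      have e : (1 / 2 : ℝ) • (x + b + m) - x = (1 / 2 : ℝ) • (m - (x - b)) := by module
      rw [e]
      exact hA.smul_nonneg _ _ h2 (sub_nonneg.2 hm1)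
    · rw [← sub_nonneg]
      have e : (1 / 2 : ℝ) • (a + x + m) - x = (1 / 2 : ℝ) • (m - -(a - x)) := by module
      rw [e]
      exact hA.smul_nonneg _ _ h2 (sub_nonneg.2 hm2)
  · intro u hu
    have hua : a ≤ u := hu (Set.mem_insert _ _)
    have hub : b ≤ u := hu (Set.mem_insert_of_mem _ rfl)
    have hmu : m ≤ (2 : ℝ) • u - (a + b) := h.2 (by
      rintro x (rfl | rfl)
      · rw [← sub_nonneg]
        have e : (2 : ℝ) • u - (a + b) - (a - b) = (2 : ℝ) • (u - a) := by module
        rw [e]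
        exact hA.smul_nonneg _ _ zero_le_two (sub_nonneg.2 hua)
      · rw [← sub_nonneg]
        have e : (2 : ℝ) • u - (a + b) - -(a - b) = (2 : ℝ) • (u - b) := by module
        rw [e]
        exact hA.smul_nonneg _ _ zero_le_two (sub_nonneg.2 hub))
    rw [← sub_nonneg]
    have e : u - (1 / 2 : ℝ) • (a + b + m) =
        (1 / 2 : ℝ) • ((2 : ℝ) • u - (a + b) - m) := by module
    rw [e]
    exact hA.smul_nonneg _ _ h2 (sub_nonneg.2 hmu)

/-- One step of the iteration `p ↦ p + (m² - p²) / 2` for the square root `m` of `m²`, in terms of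
the error `d = m - p`. -/
theorem sqrt_iteration_step {m d : A} {c : ℝ} (hm : m ≤ 1) (hd : 0 ≤ d) (hdm : d ≤ m)
    (hcomm : Commute d m) (hc : c ≤ 1) (hdc : d ≤ c • (1 : A)) :
    Commute (d - d * m + (1 / 2 : ℝ) • (d * d)) m ∧ 0 ≤ d - d * m + (1 / 2 : ℝ) • (d * d) ∧
      d - d * m + (1 / 2 : ℝ) • (d * d) ≤ m ∧
      d - d * m + (1 / 2 : ℝ) • (d * d) ≤ (c - c ^ 2 / 2) • (1 : A) := by
  have := hA.isOrderedAddMonoid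
  have hdd : 0 ≤ d * d := hA.mul_nonneg _ _ hd hd
  have hle : d - d * m + (1 / 2 : ℝ) • (d * d) ≤ d - (1 / 2 : ℝ) • (d * d) := by
    rw [← sub_nonneg]
    have e : d - (1 / 2 : ℝ) • (d * d) - (d - d * m + (1 / 2 : ℝ) • (d * d)) = d * (m - d) := by
      rw [mul_sub]; module
    rw [e]
    exact hA.mul_nonneg _ _ hd (sub_nonneg.2 hdm)
  refine ⟨?_, ?_, ?_, hle.trans ?_⟩
  · exact (hcomm.sub_left (hcomm.mul_left (Commute.refl m))).add_left
      ((hcomm.mul_left hcomm).smul_left _)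
  · have e : d - d * m + (1 / 2 : ℝ) • (d * d) = d * (1 - m) + (1 / 2 : ℝ) • (d * d) := by
      rw [mul_sub, mul_one]
    rw [e]
    exact add_nonneg (hA.mul_nonneg _ _ hd (sub_nonneg.2 hm))
      (hA.smul_nonneg _ _ (by norm_num) hdd)
  · exact hle.trans ((sub_le_self _ (hA.smul_nonneg _ _ (by norm_num) hdd)).trans hdm)
  · rw [← sub_nonneg]
    have e : (c - c ^ 2 / 2) • (1 : A) - (d - (1 / 2 : ℝ) • (d * d)) =
        (c • (1 : A) - d) * ((1 - c) • (1 : A) + (1 / 2 : ℝ) • (c • (1 : A) - d)) := by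
      simp only [mul_add, sub_mul, mul_sub, smul_mul_assoc, mul_smul_comm, one_mul, mul_one,
        smul_sub, smul_smul]
      module
    rw [e]
    exact hA.mul_nonneg _ _ (sub_nonneg.2 hdc) (add_nonneg
      (hA.smul_nonneg _ _ (sub_nonneg.2 hc) hA.one_nonneg)
      (hA.smul_nonneg _ _ (by norm_num) (sub_nonneg.2 hdc)))

/-- A closed subalgebra containing `t` contains every `m` with `0 ≤ m ≤ 1` and
`m² = t²`: the iteration `p ↦ p + (t² - p²) / 2`, started at `0`, gives polynomials in `t`
whose distance to `m` is at most `2 / (n + 2)`. -/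
theorem mem_of_sq_eq {C : Subalgebra ℝ A} (hC : IsClosed (C : Set A)) {t m : A} (ht : t ∈ C)
    (hm0 : 0 ≤ m) (hm : m ≤ 1) (hsq : m * m = t * t) : m ∈ C := by
  have key : ∀ n : ℕ, ∃ d : A, m - d ∈ C ∧ Commute d m ∧ 0 ≤ d ∧ d ≤ m ∧
      d ≤ (2 / ((n : ℝ) + 2)) • (1 : A) := by
    intro n
    induction n with
    | zero =>
      refine ⟨m, by rw [sub_self]; exact C.zero_mem, Commute.refl m, hm0, le_rfl, ?_⟩
      simpa using hm
    | succ n ih =>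
      obtain ⟨d, hd, hcomm, hd0, hdm, hdc⟩ := ih
      have hn : (0 : ℝ) < (n : ℝ) + 2 := by positivity
      obtain ⟨h1, h2, h3, h4⟩ := hA.sqrt_iteration_step hm hd0 hdm hcomm
        ((div_le_one hn).2 (by linarith [(Nat.cast_nonneg n : (0 : ℝ) ≤ n)])) hdc
      refine ⟨_, ?_, h1, h2, h3, h4.trans ?_⟩
      · have e : m - (d - d * m + (1 / 2 : ℝ) • (d * d)) =
            (m - d) + (1 / 2 : ℝ) • (t * t - (m - d) * (m - d)) := by
          rw [← hsq, sub_mul, mul_sub, mul_sub, ← hcomm.eq]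
          module
        rw [e]
        exact C.add_mem hd (C.smul_mem (C.sub_mem (C.mul_mem ht ht) (C.mul_mem hd hd)) _)
      · have := hA.isOrderedAddMonoid
        rw [← sub_nonneg, ← sub_smul]
        refine hA.smul_nonneg _ _ ?_ hA.one_nonneg
        push_cast
        have e : 2 / ((n : ℝ) + 1 + 2) - (2 / ((n : ℝ) + 2) - (2 / ((n : ℝ) + 2)) ^ 2 / 2) =
            2 / (((n : ℝ) + 2) ^ 2 * ((n : ℝ) + 3)) := by
          field_simp
          ring
        rw [e]
        positivity
  choose d hd _ hd0 _ hdc using key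
  have hlim : Filter.Tendsto (fun n => m - d n) Filter.atTop (nhds m) := by
    rw [tendsto_iff_norm_sub_tendsto_zero]
    have hz : Filter.Tendsto (fun n : ℕ => 2 / ((n : ℝ) + 2)) Filter.atTop (nhds 0) :=
      tendsto_const_nhds.div_atTop
        (Filter.tendsto_atTop_add_const_right _ _ tendsto_natCast_atTop_atTop)
    refine squeeze_zero (fun n => norm_nonneg _) (fun n => ?_) hz
    rw [sub_sub_cancel_left, norm_neg]
    have hn : (0 : ℝ) ≤ 2 / ((n : ℝ) + 2) := by positivity
    refine (hA.norm_le_iff _ _ hn).2 ⟨?_, hdc n⟩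
    have := hA.isOrderedAddMonoid
    exact (neg_nonpos.2 (hA.smul_nonneg _ _ hn hA.one_nonneg)).trans (hd0 n)
  exact hC.mem_of_tendsto hlim (Filter.Eventually.of_forall hd)

end IsUnitOrderedAlgebra

/-! ### The commutant in the algebra of orthomorphisms -/

namespace Orth

variable {E : Type*} [NormedAddCommGroup E] [NormedSpace ℝ E] [Lattice E] [IsOrderedAddMonoid E]
  [HasSolidNorm E] [IsOrderedModule ℝ E] [CompleteSpace E]

theorem isUnitOrderedAlgebra : IsUnitOrderedAlgebra (Orth E) where
  add_le_add_left _ _ U h := add_le_add_right h U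
  smul_nonneg _ _ hr hT x hx := smul_nonneg hr (hT x hx)
  mul_nonneg _ _ hS hT x hx := hS _ (hT x hx)
  archimedean _ _ h x hx := VectorLattice.archimedean_of_hasSolidNorm _ _ fun n => h n x hx
  one_nonneg _ hx := hx
  norm_le_iff _ T hr := norm_le_iff hr T

theorem exists_isLUB_mem {C : Subalgebra ℝ (Orth E)} (hC : IsClosed (C : Set (Orth E)))
    {S T : Orth E} (hS : S ∈ C) (hT : T ∈ C) : ∃ U ∈ C, IsLUB {S, T} U := by
  obtain ⟨A, hA⟩ := exists_modulus (S - T)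
  have hlub := isLUB_modulus hA
  have hnorm := (norm_le_iff (norm_nonneg (S - T)) (S - T)).1 le_rfl
  have hsq := modulus_mul_self (norm_nonneg (S - T)) hnorm.2 hnorm.1 hA
  have hA0 : 0 ≤ A := fun x hx => by rw [hA x hx]; exact abs_nonneg _
  have hAle : A ≤ ‖S - T‖ • (1 : Orth E) := hlub.2 (by
    rintro U (rfl | rfl)
    · exact hnorm.2
    · exact neg_le.1 hnorm.1)
  -- rescale by a positive number, so that the modulus is at most the identity
  set r := ‖S - T‖ + 1 with hr
  have hr0 : 0 < r := by positivity
  have hAr : A ≤ r • (1 : Orth E) := by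
    rw [hr, add_smul, one_smul]
    exact hAle.trans (le_add_of_nonneg_right isUnitOrderedAlgebra.one_nonneg)
  have hmem : r⁻¹ • A ∈ C := by
    refine isUnitOrderedAlgebra.mem_of_sq_eq hC (C.smul_mem (C.sub_mem hS hT) r⁻¹)
      (isUnitOrderedAlgebra.smul_nonneg _ _ (inv_nonneg.2 hr0.le) hA0) ?_ ?_
    · have := isUnitOrderedAlgebra.smul_le_smul (inv_nonneg.2 hr0.le) hAr
      rwa [smul_smul, inv_mul_cancel₀ hr0.ne', one_smul] at this
    · simp only [smul_mul_assoc, mul_smul_comm, hsq]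
  have hAC : A ∈ C := by
    have := C.smul_mem hmem r
    rwa [smul_smul, mul_inv_cancel₀ hr0.ne', one_smul] at this
  exact ⟨_, C.smul_mem (C.add_mem (C.add_mem hS hT) hAC) _,
    isUnitOrderedAlgebra.isLUB_pair hlub⟩

/-- Every closed unital subalgebra of `Orth(E)` is a Banach f-subalgebra. -/
theorem isBanachFSubalgebra_of_isClosed {C : Subalgebra ℝ (Orth E)}
    (hC : IsClosed (C : Set (Orth E))) : IsBanachFSubalgebra C where
  sup_mem S hS T hT := exists_isLUB_mem hC hS hT
  inf_mem S hS T hT := by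
    obtain ⟨U, hU, hlub⟩ := exists_isLUB_mem hC (C.neg_mem hS) (C.neg_mem hT)
    exact ⟨-U, C.neg_mem hU, by simpa using hlub.neg⟩
  isBanachFAlgebra := by
    have : CompleteSpace C := hC.completeSpace_coe
    refine (isUnitOrderedAlgebra.subalgebra C).isBanachFAlgebra fun S T => ?_
    obtain ⟨U, hU, hlub⟩ := exists_isLUB_mem hC S.2 T.2
    refine ⟨⟨U, hU⟩, ?_, fun V hV => hlub.2 ?_⟩
    · rintro V (rfl | rfl)
      · exact hlub.1 (Set.mem_insert _ _)
      · exact hlub.1 (Set.mem_insert_of_mem _ rfl)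
    · rintro W (rfl | rfl)
      · exact hV (Set.mem_insert _ _)
      · exact hV (Set.mem_insert_of_mem _ rfl)

theorem isBanachFAlgebra : IsBanachFAlgebra (Orth E) := by
  refine isUnitOrderedAlgebra.isBanachFAlgebra fun S T => ?_
  obtain ⟨U, -, hU⟩ := exists_isLUB_mem (C := ⊤) isClosed_univ (S := S) (T := T)
    Algebra.mem_top Algebra.mem_top
  exact ⟨U, hU⟩

/-- The commutant in `Orth(E)` as a subalgebra: the trace on `Orth(E)` of the centralizer in the
algebra of bounded operators. -/
def commutant (𝒮 : Set (E →L[ℝ] E)) : Subalgebra ℝ (Orth E) :=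
  (Subalgebra.centralizer ℝ 𝒮).comap Orth.toCLM

theorem coe_commutant (𝒮 : Set (E →L[ℝ] E)) :
    (commutant 𝒮 : Set (Orth E)) = orthCommutant 𝒮 := by
  ext T
  refine forall₂_congr fun S _ => ?_
  constructor
  · intro h
    exact congrArg ContinuousLinearMap.toLinearMap h.symm
  · intro h
    exact ContinuousLinearMap.coe_injective h.symm

theorem isClosed_commutant (𝒮 : Set (E →L[ℝ] E)) : IsClosed (commutant 𝒮 : Set (Orth E)) :=
  (Set.isClosed_centralizer 𝒮).preimage isometry_toCLM.continuous

end Orth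

theorem mainTheorem11 {E : Type*} [NormedAddCommGroup E] [NormedSpace ℝ E] [Lattice E]
    [IsOrderedAddMonoid E] [IsOrderedModule ℝ E] [HasSolidNorm E] [CompleteSpace E]
    (𝒮 : Set (E →L[ℝ] E)) (h𝒮 : 𝒮.Nonempty) :
    (IsBanachFAlgebra (Orth E) ∧ IsStrongOrderUnit (1 : Orth E) ∧
      ∀ T : Orth E, ‖T‖ = orderUnitNorm 1 T) ∧
    ∃ C : Subalgebra ℝ (Orth E), (C : Set (Orth E)) = orthCommutant 𝒮 ∧
      IsBanachFSubalgebra C ∧ IsStrongOrderUnit (1 : C) :=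
  ⟨⟨Orth.isBanachFAlgebra, Orth.isUnitOrderedAlgebra.isStrongOrderUnit,
    Orth.isUnitOrderedAlgebra.norm_eq_orderUnitNorm⟩,
    Orth.commutant 𝒮, Orth.coe_commutant 𝒮,
    Orth.isBanachFSubalgebra_of_isClosed (Orth.isClosed_commutant 𝒮),
    (Orth.isUnitOrderedAlgebra.subalgebra _).isStrongOrderUnit⟩
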